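/- Let $0\le l\le n$ be integers, and put $\varepsilon_i=1$ for $1\le i\le n-l$ and $\varepsilon_i=-1$ for $n-l<i\le n$. The reflection algebra $\mathcal B(n,l)$ is the unital associative algebra over $\mathbb C$ with generators $b_{ij}^{(r)}$ ($1\le i,j\le n$, $r\ge 1$) and the following defining relations, written in terms of the formal series $$b_{ij}(u)=\sum_{r\ge 0}b_{ij}^{(r)}u^{-r},\qquad b_{ij}^{(0)}=\delta_{ij}\varepsilon_i :$$ the reflection equation $$\begin{aligned}{}[b_{ij}(u),b_{rs}(v)]&=\frac{1}{u-v}\Big(b_{rj}(u)b_{is}(v)-b_{rj}(v)b_{is}(u)\Big)\\&+\frac{1}{u+v}\Big(\delta_{rj}\sum_{a=1}^n b_{ia}(u)b_{as}(v)-\delta_{is}\sum_{a=1}^n b_{ra}(v)b_{aj}(u)\Big)\\&-\frac{1}{u^2-v^2}\,\delta_{ij}\Big(\sum_{a=1}^n b_{ra}(u)b_{as}(v)-\sum_{a=1}^n b_{ra}(v)b_{as}(u)\Big)\end{aligned}$$ (understood as an identity of formal series in $u^{-1},v^{-1}$ after multiplication by $u^2-v^2$), and the unitary condition $$\sum_{a=1}^n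 b_{ia}(u)b_{aj}(-u)=\delta_{ij}.$$ A highest vector of a representation $V$ of $\mathcal B(n,l)$ is a nonzero vector $\xi\in V$ which generates $V$ as a $\mathcal B(n,l)$-module and satisfies $b_{ij}(u)\,\xi=0$ for all $1\le i<j\le n$ and $b_{ii}(u)\,\xi=\mu_i(u)\,\xi$ for $1\le i\le n$, for some formal series $\mu_i(u)\in\varepsilon_i+u^{-1}\mathbb C[[u^{-1}]]$. The representation $V$ is called a highest weight representation if it has a highest vector. **Theorem.** Every finite-dimensional irreducible representation $V$ of the algebra $\mathcal B(n,l)$ is a highest weight representation. Moreover, the highest vector of $V$ is unique up to a nonzero constant factor: if $\xi$ and $\eta$ are highest vectors of $V$, then $\eta=c\,\xi$ for some $c\in\mathbb C$, $c\neq 0$. -/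

import Mathlib

noncomputable section

namespace ReflectionAlgebra

open PowerSeries

/-- The diagonal signs `ε_i` of `G = diag(1,…,1,-1,…,-1)`, with `n - l` entries `1` followed by
`l` entries `-1` (indices start from `0`). -/
def eps (n l : ℕ) (i : Fin n) : ℂ := if (i : ℕ) + l < n then 1 else -1

section Series

variable {A : Type*} [Ring A] {n : ℕ}

/-! Series in `u⁻¹` and `v⁻¹` with coefficients in a ring `A` are elements of `A⟦X⟧⟦X⟧`: the outer
variable is `x = u⁻¹`, the inner variable is `y = v⁻¹`. Both commute with `A`. -/

/-- `u⁻¹` -/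
def uInv : PowerSeries (PowerSeries A) := X

/-- `v⁻¹` -/
def vInv : PowerSeries (PowerSeries A) := C X

/-- `c(u) = ∑ c_p u^(-p)` -/
def inU (c : ℕ → A) : PowerSeries (PowerSeries A) := PowerSeries.map C (PowerSeries.mk c)

/-- `c(v) = ∑ c_q v^(-q)` -/
def inV (c : ℕ → A) : PowerSeries (PowerSeries A) := C (PowerSeries.mk c)

/-- The left-hand side `[b_ij(u), b_rs(v)]` of the reflection equation in matrix elements,
multiplied by `u⁻² v⁻² (u² - v²) = v⁻² - u⁻²`. -/
def reflectionLHS (b : Fin n → Fin n → ℕ → A) (i j r s : Fin n) : PowerSeries (PowerSeries A) :=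
  (vInv ^ 2 - uInv ^ 2) * (inU (b i j) * inV (b r s) - inV (b r s) * inU (b i j))

/-- The right-hand side of the reflection equation in matrix elements,
`1/(u-v) (b_rj(u) b_is(v) - b_rj(v) b_is(u))`
`+ 1/(u+v) (δ_rj ∑ₐ b_ia(u) b_as(v) - δ_is ∑ₐ b_ra(v) b_aj(u))`
`- 1/(u²-v²) δ_ij (∑ₐ b_ra(u) b_as(v) - ∑ₐ b_ra(v) b_as(u))`,
multiplied by `u⁻² v⁻² (u² - v²)`. -/
def reflectionRHS (b : Fin n → Fin n → ℕ → A) (i j r s : Fin n) : PowerSeries (PowerSeries A) :=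
  uInv * vInv * (uInv + vInv) *
      (inU (b r j) * inV (b i s) - inV (b r j) * inU (b i s))
    + uInv * vInv * (vInv - uInv) *
      ((if r = j then ∑ a, inU (b i a) * inV (b a s) else 0)
        - (if i = s then ∑ a, inV (b r a) * inU (b a j) else 0))
    - uInv ^ 2 * vInv ^ 2 *
      (if i = j then (∑ a, inU (b r a) * inV (b a s)) - ∑ a, inV (b r a) * inU (b a s) else 0)

/-- The matrix element `∑ₐ b_ia(u) b_aj(-u)` of `B(u) B(-u)`, a series in `u⁻¹`. -/
def unitarityLHS (b : Fin n → Fin n → ℕ → A) (i j : Fin n) : PowerSeries A :=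
  ∑ a, PowerSeries.mk (b i a) * PowerSeries.mk (fun p => (-1) ^ p * b a j p)

end Series

/-- The free algebra on symbols indexed by `(i, j, p)`, the symbol with index `(i, j, p)` standing
for `b_ij^(p+1)`. -/
abbrev Free (n : ℕ) : Type := FreeAlgebra ℂ (Fin n × Fin n × ℕ)

/-- The coefficients `b_ij^(p)`, `p ≥ 0`, in the free algebra; `b_ij^(0) = δ_ij ε_i`. -/
def freeGen (n l : ℕ) (i j : Fin n) : ℕ → Free n
  | 0 => if i = j then algebraMap ℂ (Free n) (eps n l i) else 0
  | p + 1 => FreeAlgebra.ι ℂ (i, j, p)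

/-- The defining relations: all the coefficients of the reflection equation and of the unitary
condition `B(u) B(-u) = 1`. -/
inductive Rel (n l : ℕ) : Free n → Free n → Prop
  | reflection (i j r s : Fin n) (p q : ℕ) :
      Rel n l (coeff q (coeff p (reflectionLHS (freeGen n l) i j r s)))
        (coeff q (coeff p (reflectionRHS (freeGen n l) i j r s)))
  | unitarity (i j : Fin n) (p : ℕ) :
      Rel n l (coeff p (unitarityLHS (freeGen n l) i j))
        (coeff p (if i = j then (1 : PowerSeries (Free n)) else 0))

end ReflectionAlgebra

open ReflectionAlgebra in
/-- The reflection algebra `B(n,l)`. -/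
def ReflectionAlgebra (n l : ℕ) : Type := RingQuot (Rel n l)

namespace ReflectionAlgebra

instance (n l : ℕ) : Ring (ReflectionAlgebra n l) := inferInstanceAs (Ring (RingQuot (Rel n l)))

instance (n l : ℕ) : Algebra ℂ (ReflectionAlgebra n l) :=
  inferInstanceAs (Algebra ℂ (RingQuot (Rel n l)))

/-- The element `b_ij^(p)` of `B(n,l)`, `p ≥ 0`. -/
def b (n l : ℕ) (i j : Fin n) (p : ℕ) : ReflectionAlgebra n l :=
  RingQuot.mkAlgHom ℂ (Rel n l) (freeGen n l i j p)

/-- `ξ` is a highest vector of the representation `V` of `B(n,l)`, of highest weight `μ(u)`. -/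
structure IsHighestVectorOfWeight (n l : ℕ) {V : Type*} [AddCommGroup V] [Module ℂ V]
    [Module (ReflectionAlgebra n l) V] (μ : Fin n → PowerSeries ℂ) (ξ : V) : Prop where
  ne_zero : ξ ≠ 0
  generates : Submodule.span (ReflectionAlgebra n l) {ξ} = ⊤
  constantCoeff_weight : ∀ i, PowerSeries.constantCoeff (μ i) = eps n l i
  upper : ∀ i j : Fin n, i < j → ∀ p : ℕ, b n l i j p • ξ = 0
  diagonal : ∀ (i : Fin n) (p : ℕ), b n l i i p • ξ = PowerSeries.coeff p (μ i) • ξ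

/-- `ξ` is a highest vector of the representation `V` of `B(n,l)`, for some highest weight. -/
def IsHighestVector (n l : ℕ) {V : Type*} [AddCommGroup V] [Module ℂ V]
    [Module (ReflectionAlgebra n l) V] (ξ : V) : Prop :=
  ∃ μ : Fin n → PowerSeries ℂ, IsHighestVectorOfWeight n l μ ξ

/-- The representation `V` of `B(n,l)` is a highest weight representation. -/
def IsHighestWeight (n l : ℕ) (V : Type*) [AddCommGroup V] [Module ℂ V]
    [Module (ReflectionAlgebra n l) V] : Prop :=
  ∃ ξ : V, IsHighestVector n l ξ

end ReflectionAlgebra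

end

/-! The coefficients of the reflection equation at `u⁻¹` show that the `b_ii^(1)` act on all
generators by commutator diagonally. A suitable combination `grading` of them satisfies `[grading,
b_rs(u)] = (s - r) b_rs(u)`, so generators with `r < s` raise its eigenvalue, diagonal ones preserve
it and the others lower it.

Existence: by finite dimension there is an eigenvalue of `grading` with maximal real part, and its
eigenspace is killed by every raising generator. It is stable under the `b_ii(u)`, which commute on
it (`diagonal_smul_comm`), so it contains a common eigenvector; irreducibility makes that vector
cyclic. The commutation holds only on vectors killed by the raising generators. It is obtained from
the reflection equation as linear algebra over the domain `ℂ⟦X⟧⟦X⟧`, after pairing with a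
functional.

Uniqueness: give `b_ij^(p)` degree `p`. Generators commute modulo lower degree (`bracket_mem`), so
every element is a combination of words with lowering letters on the left (`smul_mem_span`). Applied
to a highest vector `ξ` of eigenvalue `a`, these give multiples of `ξ` and vectors of eigenvalue `a
- 1, a - 2, …` (`span_sup_eq_top`). Two highest vectors thus have the same eigenvalue, whose
eigenspace is a line. -/

noncomputable section

namespace ReflectionAlgebra

open PowerSeries

/-! ### Coefficients of double series over a noncommutative ring. -/

section Coefficients

variable {A : Type*} [Ring A] {n : ℕ}

/-- The coefficient of `u^(-p) v^(-q)`. -/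
def bicoeff (p q : ℕ) (F : A⟦X⟧⟦X⟧) : A := coeff q (coeff p F)

theorem bicoeff_add (p q : ℕ) (F G : A⟦X⟧⟦X⟧) :
    bicoeff p q (F + G) = bicoeff p q F + bicoeff p q G := by simp [bicoeff]

theorem bicoeff_sub (p q : ℕ) (F G : A⟦X⟧⟦X⟧) :
    bicoeff p q (F - G) = bicoeff p q F - bicoeff p q G := by simp [bicoeff]

theorem bicoeff_zero (p q : ℕ) : bicoeff p q (0 : A⟦X⟧⟦X⟧) = 0 := by simp [bicoeff]

theorem bicoeff_sum {ι : Type*} (s : Finset ι) (p q : ℕ) (F : ι → A⟦X⟧⟦X⟧) :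
    bicoeff p q (∑ a ∈ s, F a) = ∑ a ∈ s, bicoeff p q (F a) := by simp [bicoeff]

theorem bicoeff_uInv_mul_zero (q : ℕ) (F : A⟦X⟧⟦X⟧) : bicoeff 0 q (uInv * F) = 0 := by
  simp [bicoeff, uInv]

theorem bicoeff_uInv_mul_succ (p q : ℕ) (F : A⟦X⟧⟦X⟧) :
    bicoeff (p + 1) q (uInv * F) = bicoeff p q F := by
  simp [bicoeff, uInv, coeff_succ_X_mul]

theorem bicoeff_uInv_one (q : ℕ) (F : A⟦X⟧⟦X⟧) :
    bicoeff 1 q (uInv * F) = bicoeff 0 q F := bicoeff_uInv_mul_succ 0 q F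

theorem bicoeff_vInv_mul_zero (p : ℕ) (F : A⟦X⟧⟦X⟧) : bicoeff p 0 (vInv * F) = 0 := by
  simp [bicoeff, vInv, coeff_C_mul]

theorem bicoeff_vInv_mul_succ (p q : ℕ) (F : A⟦X⟧⟦X⟧) :
    bicoeff p (q + 1) (vInv * F) = bicoeff p q F := by
  simp [bicoeff, vInv, coeff_C_mul, coeff_succ_X_mul]

theorem bicoeff_inU_mul_inV (c d : ℕ → A) (p q : ℕ) :
    bicoeff p q (inU c * inV d) = c p * d q := by
  simp [bicoeff, inU, inV, coeff_mul_C, coeff_C_mul]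

theorem bicoeff_inV_mul_inU (c d : ℕ → A) (p q : ℕ) :
    bicoeff p q (inV d * inU c) = d q * c p := by
  simp [bicoeff, inU, inV, coeff_mul_C, coeff_C_mul]

theorem uInv_mul_vInv : (uInv * vInv : A⟦X⟧⟦X⟧) = vInv * uInv :=
  ((commute_X (vInv : A⟦X⟧⟦X⟧)).eq).symm

theorem reflectionLHS_eq (b : Fin n → Fin n → ℕ → A) (i j r s : Fin n) :
    reflectionLHS b i j r s =
      vInv * (vInv * (inU (b i j) * inV (b r s) - inV (b r s) * inU (b i j)))
      - uInv * (uInv * (inU (b i j) * inV (b r s) - inV (b r s) * inU (b i j))) := by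
  simp only [reflectionLHS, sq, sub_mul, mul_assoc]

/-- Every term is brought to the form of `u⁻¹` and `v⁻¹` multiplying on the left, so that
coefficients can be read off by index shifts. -/
theorem reflectionRHS_eq (b : Fin n → Fin n → ℕ → A) (i j r s : Fin n) :
    reflectionRHS b i j r s =
      (let P := inU (b r j) * inV (b i s) - inV (b r j) * inU (b i s)
       let Q := (if r = j then ∑ a, inU (b i a) * inV (b a s) else 0)
        - (if i = s then ∑ a, inV (b r a) * inU (b a j) else 0)
       let R := (if i = j then
        (∑ a, inU (b r a) * inV (b a s)) - ∑ a, inV (b r a) * inU (b a s) else 0)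
       uInv * (uInv * (vInv * P)) + uInv * (vInv * (vInv * P))
        + (uInv * (vInv * (vInv * Q)) - uInv * (uInv * (vInv * Q)))
        - uInv * (uInv * (vInv * (vInv * R)))) := by
  have h (F : A⟦X⟧⟦X⟧) : vInv * (uInv * F) = uInv * (vInv * F) := by
    rw [← mul_assoc, ← uInv_mul_vInv, mul_assoc]
  simp only [reflectionRHS, sq, mul_add, mul_sub, add_mul, sub_mul, mul_assoc, h]
  abel

section Map

variable {A' : Type*} [Ring A'] (f : A →+* A')

theorem map_map_inU (c : ℕ → A) : map (map f) (inU c) = inU (fun p => f (c p)) := by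
  ext p q; simp [inU, coeff_C]

theorem map_map_inV (c : ℕ → A) : map (map f) (inV c) = inV (fun p => f (c p)) := by
  ext p q; simp [inV, coeff_C, apply_ite (coeff q)]

theorem map_map_uInv : map (map f) (uInv : A⟦X⟧⟦X⟧) = uInv := by simp [uInv]

theorem map_map_vInv : map (map f) (vInv : A⟦X⟧⟦X⟧) = vInv := by simp [vInv]

theorem map_map_reflectionLHS (b : Fin n → Fin n → ℕ → A) (i j r s : Fin n) :
    map (map f) (reflectionLHS b i j r s) = reflectionLHS (fun i j p => f (b i j p)) i j r s := by
  simp only [reflectionLHS, map_mul, map_sub, map_pow, map_map_inU, map_map_inV, map_map_uInv,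
    map_map_vInv]

theorem map_map_reflectionRHS (b : Fin n → Fin n → ℕ → A) (i j r s : Fin n) :
    map (map f) (reflectionRHS b i j r s) = reflectionRHS (fun i j p => f (b i j p)) i j r s := by
  simp only [reflectionRHS, map_mul, map_sub, map_add, map_pow, apply_ite (map (map f)), map_sum,
    map_map_inU, map_map_inV, map_map_uInv, map_map_vInv, map_zero]

end Map

end Coefficients

/-! ### Relations in the quotient algebra and the grading element. -/

section Relations

variable (n l : ℕ)

theorem reflection_equation (i j r s : Fin n) :
    reflectionLHS (b n l) i j r s = reflectionRHS (b n l) i j r s := by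
  have hL := map_map_reflectionLHS (RingQuot.mkAlgHom ℂ (Rel n l)).toRingHom (freeGen n l) i j r s
  have hR := map_map_reflectionRHS (RingQuot.mkAlgHom ℂ (Rel n l)).toRingHom (freeGen n l) i j r s
  refine hL.symm.trans (Eq.trans ?_ hR)
  ext p q
  rw [coeff_map, coeff_map, coeff_map, coeff_map]
  exact RingQuot.mkAlgHom_rel ℂ (Rel.reflection i j r s p q)

theorem b_zero (i j : Fin n) :
    b n l i j 0 = if i = j then algebraMap ℂ (ReflectionAlgebra n l) (eps n l i) else 0 := by
  have h : b n l i j 0 = RingQuot.mkAlgHom ℂ (Rel n l) (freeGen n l i j 0) := rfl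
  rw [h, freeGen, apply_ite (RingQuot.mkAlgHom ℂ (Rel n l)), map_zero, AlgHom.commutes]
  rfl

theorem eps_mul_eps (i : Fin n) : eps n l i * eps n l i = 1 := by
  unfold eps; split_ifs <;> simp

theorem bracket_b_one (i r s : Fin n) (q : ℕ) :
    b n l i i 1 * b n l r s q - b n l r s q * b n l i i 1 =
      (2 * eps n l i * ((if r = i then 1 else 0) - (if i = s then 1 else 0))) • b n l r s q := by
  -- At `u⁻¹ v^(-q-2)` only `v⁻²` contributes on the left. On the right only the terms with a single
  -- factor `u⁻¹` survive, and they involve just the scalars `b^(0)`.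
  have h := congrArg (bicoeff 1 (q + 2)) (reflection_equation n l i i r s)
  rw [reflectionLHS_eq, reflectionRHS_eq] at h
  simp only [bicoeff_sub, bicoeff_add, bicoeff_uInv_one,
    bicoeff_uInv_mul_zero, bicoeff_vInv_mul_succ, bicoeff_inU_mul_inV, bicoeff_inV_mul_inU,
    sub_zero, zero_add, apply_ite (bicoeff 0 q), bicoeff_sum, bicoeff_zero] at h
  rw [h]
  simp only [b_zero, ite_mul, mul_ite, zero_mul, mul_zero, Finset.sum_ite_eq, Finset.sum_ite_eq',
    Finset.mem_univ, if_true, ← Algebra.commutes, ← Algebra.smul_def]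
  by_cases h1 : r = i <;> by_cases h2 : i = s <;> subst_vars <;> simp_all [two_mul, add_smul, eq_comm]

/-- A grading element. -/
def grading : ReflectionAlgebra n l := ∑ i : Fin n, (-(i : ℂ) * eps n l i / 2) • b n l i i 1

/-- The weights `-i ε_i / 2` in `grading` cancel the factor `2 ε_i` of `bracket_b_one`, since `ε_i²
= 1`. -/
theorem grading_mul (r s : Fin n) (q : ℕ) :
    grading n l * b n l r s q = b n l r s q * grading n l + ((s : ℂ) - r) • b n l r s q := by
  rw [← sub_eq_iff_eq_add', grading, Finset.sum_mul, Finset.mul_sum, ← Finset.sum_sub_distrib]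
  simp only [smul_mul_assoc, mul_smul_comm, ← smul_sub, bracket_b_one, smul_smul]
  rw [← Finset.sum_smul]
  congr 1
  have h (i : Fin n) : -(i : ℂ) * eps n l i / 2 *
      (2 * eps n l i * ((if r = i then 1 else 0) - (if i = s then 1 else 0))) =
      (if i = s then (i : ℂ) else 0) - (if r = i then (i : ℂ) else 0) := by
    have := eps_mul_eps n l i
    trans -(i : ℂ) * ((if r = i then 1 else 0) - (if i = s then 1 else 0))
    · linear_combination -(i : ℂ) * ((if r = i then 1 else 0) - (if i = s then 1 else 0)) * this
    · split_ifs <;> ring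
  simp only [h, Finset.sum_sub_distrib, Finset.sum_ite_eq, Finset.sum_ite_eq', Finset.mem_univ,
    if_true]

end Relations

/-! ### The degree filtration and commutation modulo lower degree. -/

section Filtration

variable (n l : ℕ)

/-- The product of the generators `b_ij^(p+1)` with `(i, j, p)` running over the list `w`. -/
def word (w : List (Fin n × Fin n × ℕ)) : ReflectionAlgebra n l :=
  (w.map fun x => b n l x.1 x.2.1 (x.2.2 + 1)).prod

variable {n} in
/-- The degree of a word, where `b_ij^(p)` has degree `p`. -/
def wordDegree (w : List (Fin n × Fin n × ℕ)) : ℕ := (w.map fun x => x.2.2 + 1).sum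

/-- The span of the words of degree less than `m`. -/
def degreeLT (m : ℕ) : Submodule ℂ (ReflectionAlgebra n l) :=
  Submodule.span ℂ (word n l '' {w | wordDegree w < m})

variable {n l}

theorem word_nil : word n l [] = 1 := rfl

theorem word_cons (x : Fin n × Fin n × ℕ) (w : List (Fin n × Fin n × ℕ)) :
    word n l (x :: w) = b n l x.1 x.2.1 (x.2.2 + 1) * word n l w := by simp [word]

theorem word_append (w w' : List (Fin n × Fin n × ℕ)) :
    word n l (w ++ w') = word n l w * word n l w' := by simp [word]

theorem wordDegree_cons (x : Fin n × Fin n × ℕ) (w : List (Fin n × Fin n × ℕ)) :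
    wordDegree (x :: w) = x.2.2 + 1 + wordDegree w := by simp [wordDegree]

theorem wordDegree_append (w w' : List (Fin n × Fin n × ℕ)) :
    wordDegree (w ++ w') = wordDegree w + wordDegree w' := by simp [wordDegree]

theorem wordDegree_perm {w w' : List (Fin n × Fin n × ℕ)} (h : w.Perm w') :
    wordDegree w = wordDegree w' := (h.map _).sum_eq

theorem word_mem {w : List (Fin n × Fin n × ℕ)} {m : ℕ} (h : wordDegree w < m) :
    word n l w ∈ degreeLT n l m := Submodule.subset_span ⟨w, h, rfl⟩

theorem degreeLT_mono {m m' : ℕ} (h : m ≤ m') : degreeLT n l m ≤ degreeLT n l m' :=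
  Submodule.span_mono (Set.image_mono fun _ hw => lt_of_lt_of_le hw h)

theorem mul_mem_left {a c : ℕ} {x y : ReflectionAlgebra n l} (hx : x ∈ degreeLT n l (a + 1))
    (hy : y ∈ degreeLT n l c) : x * y ∈ degreeLT n l (a + c) := by
  have h := Submodule.mul_mem_mul hx hy
  rw [degreeLT, degreeLT, Submodule.span_mul_span] at h
  refine Submodule.span_mono ?_ h
  rintro _ ⟨_, ⟨w, hw, rfl⟩, _, ⟨w', hw', rfl⟩, rfl⟩
  refine ⟨w ++ w', ?_, word_append w w'⟩
  simp only [Set.mem_ofPred_eq, wordDegree_append] at *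
  omega

theorem mul_mem_right {a c : ℕ} {x y : ReflectionAlgebra n l} (hx : x ∈ degreeLT n l a)
    (hy : y ∈ degreeLT n l (c + 1)) : x * y ∈ degreeLT n l (a + c) := by
  have h := Submodule.mul_mem_mul hx hy
  rw [degreeLT, degreeLT, Submodule.span_mul_span] at h
  refine Submodule.span_mono ?_ h
  rintro _ ⟨_, ⟨w, hw, rfl⟩, _, ⟨w', hw', rfl⟩, rfl⟩
  refine ⟨w ++ w', ?_, word_append w w'⟩
  simp only [Set.mem_ofPred_eq, wordDegree_append] at *
  omega

theorem b_mem (i j : Fin n) (p : ℕ) : b n l i j p ∈ degreeLT n l (p + 1) := by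
  rcases p with _ | p
  · rw [b_zero]
    split_ifs
    · rw [Algebra.algebraMap_eq_smul_one]
      exact Submodule.smul_mem _ _ (word_mem (w := []) (by simp [wordDegree]))
    · exact Submodule.zero_mem _
  · have := word_mem (l := l) (w := [(i, j, p)]) (m := p + 1 + 1) (by simp [wordDegree])
    simpa [word] using this

theorem exists_mem_degreeLT (x : ReflectionAlgebra n l) : ∃ m, x ∈ degreeLT n l m := by
  obtain ⟨y, rfl⟩ := RingQuot.mkAlgHom_surjective ℂ (Rel n l) x
  induction y using FreeAlgebra.induction with
  | grade0 c =>
    refine ⟨1, ?_⟩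
    rw [AlgHom.commutes]
    change algebraMap ℂ (ReflectionAlgebra n l) c ∈ _
    rw [Algebra.algebraMap_eq_smul_one]
    exact Submodule.smul_mem _ _ (word_mem (w := []) (by simp [wordDegree]))
  | grade1 x => exact ⟨_, b_mem x.1 x.2.1 (x.2.2 + 1)⟩
  | mul x y hx hy =>
    obtain ⟨a, ha⟩ := hx
    obtain ⟨c, hc⟩ := hy
    rw [map_mul]
    exact ⟨a + c, mul_mem_left (degreeLT_mono a.le_succ ha) hc⟩
  | add x y hx hy =>
    obtain ⟨a, ha⟩ := hx
    obtain ⟨c, hc⟩ := hy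
    rw [map_add]
    exact ⟨max a c, Submodule.add_mem _ (degreeLT_mono (le_max_left a c) ha)
      (degreeLT_mono (le_max_right a c) hc)⟩

/-- The coefficient of `u^(-p) v^(-q)` in `F` has degree at most `p + q - k`. -/
def DegreeDrop (k : ℕ) (F : (ReflectionAlgebra n l)⟦X⟧⟦X⟧) : Prop :=
  ∀ p q m, p + q < m + k → bicoeff p q F ∈ degreeLT n l m

namespace DegreeDrop

variable {k : ℕ} {F G : (ReflectionAlgebra n l)⟦X⟧⟦X⟧}

theorem add (hF : DegreeDrop k F) (hG : DegreeDrop k G) : DegreeDrop k (F + G) := by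
  intro p q m h
  rw [bicoeff_add]
  exact Submodule.add_mem _ (hF p q m h) (hG p q m h)

theorem sub (hF : DegreeDrop k F) (hG : DegreeDrop k G) : DegreeDrop k (F - G) := by
  intro p q m h
  rw [bicoeff_sub]
  exact Submodule.sub_mem _ (hF p q m h) (hG p q m h)

theorem zero : DegreeDrop k (0 : (ReflectionAlgebra n l)⟦X⟧⟦X⟧) := by
  intro p q m h
  rw [bicoeff_zero]
  exact Submodule.zero_mem _

theorem sum {ι : Type*} {s : Finset ι} {F : ι → (ReflectionAlgebra n l)⟦X⟧⟦X⟧}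
    (hF : ∀ a, DegreeDrop k (F a)) : DegreeDrop k (∑ a ∈ s, F a) := by
  intro p q m h
  rw [bicoeff_sum]
  exact Submodule.sum_mem _ fun a _ => hF a p q m h

theorem ite {P : Prop} [Decidable P] (hF : DegreeDrop k F) :
    DegreeDrop k (if P then F else 0) := by
  split_ifs
  exacts [hF, zero]

theorem mono {k' : ℕ} (h : k' ≤ k) (hF : DegreeDrop k F) : DegreeDrop k' F :=
  fun p q m hm => hF p q m (by omega)

theorem uInv_mul (hF : DegreeDrop k F) : DegreeDrop (k + 1) (uInv * F) := by
  rintro (_ | p) q m h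
  · rw [bicoeff_uInv_mul_zero]
    exact Submodule.zero_mem _
  · rw [bicoeff_uInv_mul_succ]
    exact hF p q m (by omega)

theorem vInv_mul (hF : DegreeDrop k F) : DegreeDrop (k + 1) (vInv * F) := by
  rintro p (_ | q) m h
  · rw [bicoeff_vInv_mul_zero]
    exact Submodule.zero_mem _
  · rw [bicoeff_vInv_mul_succ]
    exact hF p q m (by omega)

theorem inU_mul_inV (i j r s : Fin n) : DegreeDrop 0 (inU (b n l i j) * inV (b n l r s)) := by
  intro p q m h
  rw [bicoeff_inU_mul_inV]
  exact degreeLT_mono (by omega) (mul_mem_left (b_mem i j p) (b_mem r s q))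

theorem inV_mul_inU (i j r s : Fin n) : DegreeDrop 0 (inV (b n l r s) * inU (b n l i j)) := by
  intro p q m h
  rw [bicoeff_inV_mul_inU]
  exact degreeLT_mono (by omega) (mul_mem_left (b_mem r s q) (b_mem i j p))

end DegreeDrop

/-- Each term on the right carries at least three factors `u⁻¹`, `v⁻¹`, against two on the left;
this surplus makes brackets drop in degree. -/
theorem degreeDrop_reflectionRHS (i j r s : Fin n) :
    DegreeDrop 3 (reflectionRHS (b n l) i j r s) := by
  open DegreeDrop in
  have hP := (inU_mul_inV (l := l) r j i s).sub (inV_mul_inU i s r j)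
  have hQ := ((sum (s := Finset.univ) fun a => inU_mul_inV (l := l) i a a s).ite
    (P := r = j)).sub ((sum (s := Finset.univ) fun a => inV_mul_inU (l := l) a j r a).ite
      (P := i = s))
  have hR := (((sum (s := Finset.univ) fun a => inU_mul_inV (l := l) r a a s)).sub
    (sum (s := Finset.univ) fun a => inV_mul_inU (l := l) a s r a)).ite (P := i = j)
  rw [reflectionRHS_eq]
  exact ((hP.vInv_mul.uInv_mul.uInv_mul.add hP.vInv_mul.vInv_mul.uInv_mul).add
    (hQ.vInv_mul.vInv_mul.uInv_mul.sub hQ.vInv_mul.uInv_mul.uInv_mul)).sub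
    (hR.vInv_mul.vInv_mul.uInv_mul.uInv_mul.mono (by omega))

theorem bracket_mem (i j r s : Fin n) (p q : ℕ) :
    b n l i j p * b n l r s q - b n l r s q * b n l i j p ∈ degreeLT n l (p + q) := by
  induction p using Nat.strong_induction_on generalizing q with
  | _ p ih =>
  -- The coefficient at `(p, q + 2)` is the bracket at `(p, q)` minus the one at `(p - 2, q + 2)`,
  -- which is absent for `p < 2` and covered by induction otherwise.
  have h := degreeDrop_reflectionRHS (l := l) i j r s p (q + 2) (p + q) (by omega)
  rw [← reflection_equation, reflectionLHS_eq] at h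
  simp only [bicoeff_sub, bicoeff_vInv_mul_succ, bicoeff_inU_mul_inV, bicoeff_inV_mul_inU] at h
  rcases p with _ | _ | p
  · simpa only [bicoeff_uInv_mul_zero, sub_zero] using h
  · simpa only [bicoeff_uInv_mul_zero, bicoeff_uInv_mul_succ, sub_zero] using h
  · simp only [bicoeff_sub, bicoeff_uInv_mul_succ, bicoeff_inU_mul_inV, bicoeff_inV_mul_inU] at h
    refine (Submodule.sub_mem_iff_left _ ?_).1 h
    exact degreeLT_mono (by omega) (ih p (by omega) (q + 2))

/-- Permuting the letters of a word changes it only by terms of lower degree. -/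
theorem word_sub_mem_of_perm {w w' : List (Fin n × Fin n × ℕ)} (h : w.Perm w') :
    word n l w - word n l w' ∈ degreeLT n l (wordDegree w) := by
  induction h with
  | nil => simp
  | cons x _ ih =>
    rw [word_cons, word_cons, ← mul_sub, wordDegree_cons]
    exact mul_mem_left (b_mem _ _ _) ih
  | swap x y w =>
    rw [word_cons, word_cons, word_cons, word_cons, wordDegree_cons, wordDegree_cons, ← mul_assoc,
      ← mul_assoc, ← sub_mul, ← add_assoc]
    exact mul_mem_right (bracket_mem _ _ _ _ _ _) (word_mem (Nat.lt_succ_self _))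
  | trans h _ ih ih' =>
    rw [← sub_add_sub_cancel]
    exact Submodule.add_mem _ ih (wordDegree_perm h ▸ ih')

end Filtration

/-! ### Eigenvalues of the grading element and uniqueness. -/

section HighestVector

variable {n l : ℕ} {V : Type*} [AddCommGroup V] [Module ℂ V] [Module (ReflectionAlgebra n l) V]
  [IsScalarTower ℂ (ReflectionAlgebra n l) V]

variable (n l V) in
/-- The action of the grading element. -/
def gradingEnd : Module.End ℂ V := Algebra.lsmul ℂ ℂ V (grading n l)

theorem gradingEnd_apply (ξ : V) : gradingEnd n l V ξ = grading n l • ξ := rfl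

theorem b_smul_mem_eigenspace {a : ℂ} {ξ : V} (h : ξ ∈ (gradingEnd n l V).eigenspace a)
    (i j : Fin n) (p : ℕ) :
    b n l i j p • ξ ∈ (gradingEnd n l V).eigenspace (a + ((j : ℂ) - i)) := by
  rw [Module.End.mem_eigenspace_iff, gradingEnd_apply] at *
  have := smul_comm a (b n l i j p) ξ
  rw [← mul_smul, grading_mul, add_smul, mul_smul, h, add_smul, smul_assoc, this]

theorem IsHighestVectorOfWeight.exists_mem_eigenspace {μ : Fin n → ℂ⟦X⟧} {ξ : V}
    (h : IsHighestVectorOfWeight n l μ ξ) : ∃ a, ξ ∈ (gradingEnd n l V).eigenspace a := by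
  refine ⟨∑ i : Fin n, (-(i : ℂ) * eps n l i / 2) * coeff 1 (μ i), ?_⟩
  rw [Module.End.mem_eigenspace_iff, gradingEnd_apply, grading, Finset.sum_smul, Finset.sum_smul]
  simp only [smul_assoc, h.diagonal, mul_smul]

/-- A highest vector is cyclic under the words in the strictly lower generators. -/
theorem IsHighestVectorOfWeight.smul_mem_span {μ : Fin n → ℂ⟦X⟧} {ξ : V}
    (h : IsHighestVectorOfWeight n l μ ξ) (x : ReflectionAlgebra n l) :
    x • ξ ∈ Submodule.span ℂ
      {η : V | ∃ w : List (Fin n × Fin n × ℕ), (∀ x ∈ w, x.2.1 < x.1) ∧ η = word n l w • ξ} := by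
  set N := Submodule.span ℂ
      {η : V | ∃ w : List (Fin n × Fin n × ℕ), (∀ x ∈ w, x.2.1 < x.1) ∧ η = word n l w • ξ}
  obtain ⟨m, hm⟩ := exists_mem_degreeLT x
  -- Letters that are not lowering either kill `ξ` or scale it.
  have key (w : List (Fin n × Fin n × ℕ)) (hw : ∀ x ∈ w, ¬ x.2.1 < x.1) :
      ∃ c : ℂ, word n l w • ξ = c • ξ := by
    induction w with
    | nil => exact ⟨1, by simp [word_nil]⟩
    | cons x w ih =>
      obtain ⟨c, hc⟩ := ih fun x hx => hw x (List.mem_cons_of_mem _ hx)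
      rw [word_cons, mul_smul, hc, smul_comm]
      rcases (not_lt.1 (hw x List.mem_cons_self)).lt_or_eq with hx | hx
      · exact ⟨0, by rw [h.upper _ _ hx]; simp⟩
      · rw [← hx, h.diagonal, smul_smul]
        exact ⟨_, rfl⟩
  induction m generalizing x with
  | zero =>
    simp only [degreeLT, not_lt_zero, Set.ofPred_false, Set.image_empty, Submodule.span_empty,
      Submodule.mem_bot] at hm
    simp [hm]
  | succ m ih =>
    induction hm using Submodule.span_induction with
    | zero => simp
    | add x y _ _ hx hy => rw [add_smul]; exact N.add_mem hx hy
    | smul c x _ hx => rw [smul_assoc]; exact N.smul_mem c hx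
    | mem x hx =>
      obtain ⟨w, hw, rfl⟩ := hx
      -- Move the lowering letters to the left; the error has smaller degree, so induction applies
      -- to it.
      have hp := (List.filter_append_perm (fun x : Fin n × Fin n × ℕ => decide (x.2.1 < x.1)) w).symm
      have hs := ih _ (degreeLT_mono (Nat.lt_succ_iff.1 hw) (word_sub_mem_of_perm (l := l) hp))
      rw [sub_smul] at hs
      refine (N.sub_mem_iff_left ?_).1 hs
      rw [word_append, mul_smul]
      obtain ⟨c, hc⟩ := key (w.filter fun x => !decide (x.2.1 < x.1)) (by simp)
      rw [hc, smul_comm]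
      exact N.smul_mem _ (Submodule.subset_span ⟨_, by simp, rfl⟩)

theorem IsHighestVectorOfWeight.span_sup_eq_top {μ : Fin n → ℂ⟦X⟧} {ξ : V}
    (h : IsHighestVectorOfWeight n l μ ξ) {a : ℂ} (ha : ξ ∈ (gradingEnd n l V).eigenspace a) :
    Submodule.span ℂ {ξ} ⊔ ⨆ k : ℕ, (gradingEnd n l V).eigenspace (a - (k + 1)) = ⊤ := by
  have hw (w : List (Fin n × Fin n × ℕ)) (hw : ∀ x ∈ w, x.2.1 < x.1) : w = [] ∨
      ∃ k : ℕ, word n l w • ξ ∈ (gradingEnd n l V).eigenspace (a - (k + 1)) := by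
    induction w with
    | nil => exact Or.inl rfl
    | cons x w ih =>
      right
      -- The letter lowers the eigenvalue by `d + 1`, hence `k = d` for a single letter.
      obtain ⟨d, hd⟩ := Nat.exists_eq_add_of_lt (Fin.lt_def.1 (hw x List.mem_cons_self))
      have hd' : ((x.1 : ℕ) : ℂ) = x.2.1 + d + 1 := by exact_mod_cast hd
      rw [word_cons, mul_smul]
      rcases ih fun x hx => hw x (List.mem_cons_of_mem _ hx) with rfl | ⟨k, hk⟩
      · refine ⟨d, ?_⟩
        convert b_smul_mem_eigenspace ha x.1 x.2.1 (x.2.2 + 1) using 2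
        · rw [hd']; ring
        · simp [word_nil]
      · refine ⟨k + d + 1, ?_⟩
        convert b_smul_mem_eigenspace hk x.1 x.2.1 (x.2.2 + 1) using 2
        rw [hd']; push_cast; ring
  rw [eq_top_iff]
  intro y _
  have hy : y ∈ Submodule.span (ReflectionAlgebra n l) {ξ} := h.generates ▸ Submodule.mem_top
  obtain ⟨x, rfl⟩ := Submodule.mem_span_singleton.1 hy
  refine Submodule.span_le.2 ?_ (h.smul_mem_span x)
  rintro _ ⟨w, hl, rfl⟩
  rcases hw w hl with rfl | ⟨k, hk⟩
  · rw [word_nil, one_smul]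
    exact Submodule.mem_sup_left (Submodule.mem_span_singleton_self ξ)
  · exact Submodule.mem_sup_right (Submodule.mem_iSup_of_mem k hk)

/-- The eigenspaces for `a, a - 1, …` already span `V`, and eigenspaces are independent, so no other
eigenvalue can occur. -/
theorem IsHighestVectorOfWeight.exists_eq_sub_natCast {μ : Fin n → ℂ⟦X⟧} {ξ η : V}
    (h : IsHighestVectorOfWeight n l μ ξ) {a c : ℂ} (ha : ξ ∈ (gradingEnd n l V).eigenspace a)
    (hc : η ∈ (gradingEnd n l V).eigenspace c) (hη : η ≠ 0) : ∃ k : ℕ, c = a - k := by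
  by_contra! hne
  have hd := Module.End.eigenspaces_iSupIndep (gradingEnd n l V) c
  refine hη (Submodule.disjoint_def.1 hd η hc ?_)
  have ht : (⊤ : Submodule ℂ V) ≤ ⨆ j, ⨆ _ : j ≠ c, (gradingEnd n l V).eigenspace j := by
    rw [← h.span_sup_eq_top ha]
    refine sup_le ?_ (iSup_le fun k => ?_)
    · rw [Submodule.span_singleton_le_iff_mem]
      exact Submodule.mem_iSup_of_mem a
        (Submodule.mem_iSup_of_mem (fun e => hne 0 (by simp [e])) ha)
    · refine le_iSup₂_of_le (a - (k + 1)) (fun e => hne (k + 1) ?_) le_rfl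
      rw [← e]; push_cast; rfl
  exact ht Submodule.mem_top

theorem IsHighestVector.unique {ξ η : V} (hξ : IsHighestVector n l ξ)
    (hη : IsHighestVector n l η) : ∃ c : ℂ, c ≠ 0 ∧ η = c • ξ := by
  obtain ⟨μ, hξ⟩ := hξ
  obtain ⟨ν, hη⟩ := hη
  obtain ⟨a, ha⟩ := hξ.exists_mem_eigenspace
  obtain ⟨a', ha'⟩ := hη.exists_mem_eigenspace
  obtain ⟨k, hk⟩ := hξ.exists_eq_sub_natCast ha ha' hη.ne_zero
  obtain ⟨k', hk'⟩ := hη.exists_eq_sub_natCast ha' ha hξ.ne_zero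
  -- Each eigenvalue lies below the other by a natural number, so they coincide.
  have hkk : ((k + k' : ℕ) : ℂ) = 0 := by
    push_cast
    linear_combination hk + hk'
  have hk0 : k = 0 := by
    have := Nat.cast_eq_zero.1 hkk
    omega
  subst hk0
  simp only [Nat.cast_zero, sub_zero] at hk
  subst hk
  have ht : η ∈ Submodule.span ℂ {ξ} ⊔
      ⨆ k : ℕ, (gradingEnd n l V).eigenspace (a' - (k + 1)) :=
    hξ.span_sup_eq_top ha ▸ Submodule.mem_top
  obtain ⟨_, hy, z, hz, e⟩ := Submodule.mem_sup.1 ht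
  obtain ⟨c, rfl⟩ := Submodule.mem_span_singleton.1 hy
  -- The component `z = η - c • ξ` lies both in the eigenspace of `a'` and in the sum of the
  -- strictly lower ones.
  have hz0 : z = 0 := by
    refine Submodule.disjoint_def.1 (Module.End.eigenspaces_iSupIndep (gradingEnd n l V) a') z ?_ ?_
    · rw [← eq_sub_iff_add_eq'] at e
      rw [e]
      exact Submodule.sub_mem _ ha' (Submodule.smul_mem _ _ ha)
    · refine (iSup_le fun k => ?_ :
        (⨆ k : ℕ, (gradingEnd n l V).eigenspace (a' - (k + 1))) ≤ _) hz
      refine le_iSup₂_of_le (a' - (k + 1)) (fun e => ?_) le_rfl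
      exact Nat.cast_add_one_ne_zero (R := ℂ) k (by linear_combination -e)
  rw [hz0, add_zero] at e
  refine ⟨c, ?_, e.symm⟩
  rintro rfl
  exact hη.ne_zero (by rw [← e, zero_smul])

end HighestVector

/-! ### Common eigenvectors. -/

/-- A commuting family of endomorphisms of a nonzero finite-dimensional space has a common
eigenvector. -/
theorem exists_common_eigenvector {ι V : Type*} [AddCommGroup V] [Module ℂ V]
    [FiniteDimensional ℂ V] (f : ι → Module.End ℂ V) (W : Submodule ℂ V) (hW : W ≠ ⊥)
    (hf : ∀ k, ∀ x ∈ W, f k x ∈ W) (hc : ∀ k k', ∀ x ∈ W, f k (f k' x) = f k' (f k x)) :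
    ∃ ξ ∈ W, ξ ≠ 0 ∧ ∀ k, ∃ c : ℂ, f k ξ = c • ξ := by
  -- On a minimal nonzero invariant subspace every `f k` is scalar: its eigenspaces there are
  -- invariant, by commutation on `W`, so a nonzero one is everything.
  obtain ⟨M, ⟨hMW, hM, hMf⟩, hmin⟩ := WellFounded.has_min (wellFounded_lt (α := Submodule ℂ V))
    {M | M ≤ W ∧ M ≠ ⊥ ∧ ∀ k, ∀ x ∈ M, f k x ∈ M} ⟨W, le_rfl, hW, hf⟩
  obtain ⟨ξ, hξ, hξ0⟩ := M.ne_bot_iff.1 hM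
  refine ⟨ξ, hMW hξ, hξ0, fun k => ?_⟩
  have : Nontrivial M := Submodule.nontrivial_iff_ne_bot.2 hM
  obtain ⟨c, hc'⟩ := Module.End.exists_eigenvalue ((f k).restrict (hMf k))
  obtain ⟨⟨y, hyM⟩, hy⟩ := hc'.exists_hasEigenvector
  have hyc : f k y = c • y := congrArg Subtype.val hy.apply_eq_smul
  have hy0 : y ≠ 0 := fun h => hy.2 (Subtype.ext h)
  refine ⟨c, ?_⟩
  by_contra hne
  refine hmin (M ⊓ (f k).eigenspace c) ⟨inf_le_left.trans hMW, ?_, ?_⟩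
    (lt_of_le_of_ne inf_le_left fun h => hne ?_)
  · exact (Submodule.ne_bot_iff _).2 ⟨y, ⟨hyM, Module.End.mem_eigenspace_iff.2 hyc⟩, hy0⟩
  · rintro k' x ⟨hx, hx'⟩
    refine ⟨hMf k' x hx, Module.End.mem_eigenspace_iff.2 ?_⟩
    rw [hc k k' x (hMW hx), Module.End.mem_eigenspace_iff.1 hx', map_smul]
  · exact Module.End.mem_eigenspace_iff.1 (h.ge hξ).2

/-! ### Passage to scalar series, where cancellation is available. -/

section MatrixElement

variable {A V : Type*} [Ring A] [AddCommGroup V] [Module ℂ V] [Module A V]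

/-- The series of matrix elements `φ(F ξ)`. -/
def matrixElement (φ : Module.Dual ℂ V) (ξ : V) (F : A⟦X⟧⟦X⟧) : ℂ⟦X⟧⟦X⟧ :=
  PowerSeries.mk fun p => PowerSeries.mk fun q => φ (bicoeff p q F • ξ)

variable (φ : Module.Dual ℂ V) (ξ : V) (F G : A⟦X⟧⟦X⟧)

theorem bicoeff_matrixElement (p q : ℕ) :
    bicoeff p q (matrixElement φ ξ F) = φ (bicoeff p q F • ξ) := by
  simp [bicoeff, matrixElement]

theorem bicoeff_ext {R : Type*} [Ring R] {F G : R⟦X⟧⟦X⟧}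
    (h : ∀ p q, bicoeff p q F = bicoeff p q G) : F = G := by
  ext p q; exact h p q

theorem matrixElement_add :
    matrixElement φ ξ (F + G) = matrixElement φ ξ F + matrixElement φ ξ G :=
  bicoeff_ext fun p q => by simp only [bicoeff_matrixElement, bicoeff_add, add_smul, map_add]

theorem matrixElement_sub :
    matrixElement φ ξ (F - G) = matrixElement φ ξ F - matrixElement φ ξ G :=
  bicoeff_ext fun p q => by simp only [bicoeff_matrixElement, bicoeff_sub, sub_smul, map_sub]

theorem matrixElement_zero : matrixElement φ ξ (0 : A⟦X⟧⟦X⟧) = 0 :=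
  bicoeff_ext fun p q => by simp only [bicoeff_matrixElement, bicoeff_zero, zero_smul, map_zero]

theorem matrixElement_sum {ι : Type*} (s : Finset ι) (F : ι → A⟦X⟧⟦X⟧) :
    matrixElement φ ξ (∑ a ∈ s, F a) = ∑ a ∈ s, matrixElement φ ξ (F a) :=
  bicoeff_ext fun p q => by
    simp only [bicoeff_matrixElement, bicoeff_sum, Finset.sum_smul, map_sum]

theorem matrixElement_uInv_mul : matrixElement φ ξ (uInv * F) = uInv * matrixElement φ ξ F := by
  refine bicoeff_ext fun p q => ?_
  rcases p with _ | p
  · simp only [bicoeff_matrixElement, bicoeff_uInv_mul_zero, zero_smul, map_zero]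
  · simp only [bicoeff_matrixElement, bicoeff_uInv_mul_succ]

theorem matrixElement_vInv_mul : matrixElement φ ξ (vInv * F) = vInv * matrixElement φ ξ F := by
  refine bicoeff_ext fun p q => ?_
  rcases q with _ | q
  · simp only [bicoeff_matrixElement, bicoeff_vInv_mul_zero, zero_smul, map_zero]
  · simp only [bicoeff_matrixElement, bicoeff_vInv_mul_succ]

theorem matrixElement_inU_mul_inV (c : ℕ → A) {d : ℕ → A} (hd : ∀ p, d p • ξ = 0) :
    matrixElement φ ξ (inU c * inV d) = 0 :=
  bicoeff_ext fun p q => by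
    rw [bicoeff_matrixElement, bicoeff_inU_mul_inV, mul_smul, hd, smul_zero, map_zero, bicoeff_zero]

theorem matrixElement_inV_mul_inU (c : ℕ → A) {d : ℕ → A} (hd : ∀ p, d p • ξ = 0) :
    matrixElement φ ξ (inV c * inU d) = 0 :=
  bicoeff_ext fun p q => by
    rw [bicoeff_matrixElement, bicoeff_inV_mul_inU, mul_smul, hd, smul_zero, map_zero, bicoeff_zero]

end MatrixElement

/-- This and the next three lemmas supply the factors cancelled in `sum_matrixUV_sub_matrixVU`. In
each, putting `v⁻¹ = 0` leaves a nonzero power of `u⁻¹` up to sign. -/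
theorem vInv_sub_uInv_ne_zero : (vInv - uInv : ℂ⟦X⟧⟦X⟧) ≠ 0 := fun h => by
  have := congrArg (bicoeff 1 0) h
  simp [bicoeff, uInv, vInv] at this

theorem vInv_sub_uInv_sub_ne_zero : (vInv - uInv - uInv * vInv : ℂ⟦X⟧⟦X⟧) ≠ 0 := fun h => by
  have := congrArg (bicoeff 1 0) h
  rw [mul_comm] at this
  simp only [bicoeff_sub, bicoeff_vInv_mul_zero] at this
  simp [bicoeff, uInv, vInv] at this

theorem uInv_add_vInv_sub_ne_zero (m : ℂ⟦X⟧⟦X⟧) :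
    (uInv + vInv - m * (uInv * vInv) : ℂ⟦X⟧⟦X⟧) ≠ 0 := fun h => by
  have := congrArg (bicoeff 1 0) h
  rw [← mul_assoc, mul_comm _ vInv] at this
  simp only [bicoeff_sub, bicoeff_vInv_mul_zero] at this
  simp [bicoeff, uInv, vInv] at this

theorem sq_sub_ne_zero : ((vInv - uInv) ^ 2 - (uInv * vInv) ^ 2 : ℂ⟦X⟧⟦X⟧) ≠ 0 := fun h => by
  have e : (vInv * (vInv - 2 * uInv - uInv ^ 2 * vInv) + uInv ^ 2 : ℂ⟦X⟧⟦X⟧) = 0 := by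
    linear_combination h
  have := congrArg (bicoeff 2 0) e
  rw [bicoeff_add, bicoeff_vInv_mul_zero] at this
  simp [bicoeff, uInv, coeff_X_pow] at this

/-! ### Commutation of the diagonal generators on vectors killed by the raising ones. -/

section Commute

variable {n l : ℕ} {V : Type*} [AddCommGroup V] [Module ℂ V] [Module (ReflectionAlgebra n l) V]

variable (n l) in
/-- The matrix elements of `b_ij(u) b_rs(v)`. -/
def matrixUV (φ : Module.Dual ℂ V) (ξ : V) (i j r s : Fin n) : ℂ⟦X⟧⟦X⟧ :=
  matrixElement φ ξ (inU (b n l i j) * inV (b n l r s))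

variable (n l) in
/-- The matrix elements of `b_ij(v) b_rs(u)`. -/
def matrixVU (φ : Module.Dual ℂ V) (ξ : V) (i j r s : Fin n) : ℂ⟦X⟧⟦X⟧ :=
  matrixElement φ ξ (inV (b n l i j) * inU (b n l r s))

theorem matrixElement_reflection (φ : Module.Dual ℂ V) (ξ : V) (i j r s : Fin n) :
    (vInv ^ 2 - uInv ^ 2) * (matrixUV n l φ ξ i j r s - matrixVU n l φ ξ r s i j) =
      uInv * vInv * (uInv + vInv) * (matrixUV n l φ ξ r j i s - matrixVU n l φ ξ r j i s)
      + uInv * vInv * (vInv - uInv) *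
        ((if r = j then ∑ a, matrixUV n l φ ξ i a a s else 0)
          - (if i = s then ∑ a, matrixVU n l φ ξ r a a j else 0))
      - uInv ^ 2 * vInv ^ 2 *
        (if i = j then ∑ a, matrixUV n l φ ξ r a a s - ∑ a, matrixVU n l φ ξ r a a s else 0) := by
  have h := congrArg (matrixElement φ ξ) (reflection_equation n l i j r s)
  rw [reflectionLHS_eq, reflectionRHS_eq] at h
  simp only [matrixElement_add, matrixElement_sub, matrixElement_uInv_mul, matrixElement_vInv_mul,
    apply_ite (matrixElement φ ξ), matrixElement_sum, matrixElement_zero] at h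
  simp only [matrixUV, matrixVU]
  linear_combination h

variable {ξ : V}

/-- On a vector annihilated by all `b_ij(u)` with `i < j`, the series
`∑ₐ (b_ra(u) b_ar(v) - b_ra(v) b_ar(u))` vanishes. -/
theorem sum_matrixUV_sub_matrixVU (hξ : ∀ i j : Fin n, i < j → ∀ p : ℕ, b n l i j p • ξ = 0)
    (φ : Module.Dual ℂ V) :
    (∀ r : Fin n, ∑ a, matrixUV n l φ ξ r a a r - ∑ a, matrixVU n l φ ξ r a a r = 0) ∧
    ∀ i r : Fin n, matrixUV n l φ ξ i i r r - matrixVU n l φ ξ r r i i = 0 := by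
  have hU (i j r s : Fin n) (h : r < s) : matrixUV n l φ ξ i j r s = 0 :=
    matrixElement_inU_mul_inV φ ξ _ (hξ r s h)
  have hV (i j r s : Fin n) (h : r < s) : matrixVU n l φ ξ i j r s = 0 :=
    matrixElement_inV_mul_inU φ ξ _ (hξ r s h)
  have RE := matrixElement_reflection (n := n) (l := l) φ ξ
  set S : Fin n → ℂ⟦X⟧⟦X⟧ := fun r => ∑ a, matrixUV n l φ ξ r a a r with hS
  set S' : Fin n → ℂ⟦X⟧⟦X⟧ := fun r => ∑ a, matrixVU n l φ ξ r a a r with hS'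
  set K : Fin n → Fin n → ℂ⟦X⟧⟦X⟧ :=
    fun i r => matrixUV n l φ ξ i i r r - matrixVU n l φ ξ r r i i with hK
  set D : Fin n → ℂ⟦X⟧⟦X⟧ := fun r => S r - S' r with hD
  set Y : Fin n → Fin n → ℂ⟦X⟧⟦X⟧ :=
    fun r a => matrixUV n l φ ξ r a a r - matrixVU n l φ ξ r a a r with hY
  set x : ℂ⟦X⟧⟦X⟧ := uInv with hx
  set y : ℂ⟦X⟧⟦X⟧ := vInv with hy
  have nsub : y - x ≠ 0 := vInv_sub_uInv_ne_zero
  have nm (m : ℂ⟦X⟧⟦X⟧) : x + y - m * (x * y) ≠ 0 := uInv_add_vInv_sub_ne_zero m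
  have nadd : x + y ≠ 0 := by simpa using nm 0
  have nsq : (y - x) ^ 2 - (x * y) ^ 2 ≠ 0 := sq_sub_ne_zero
  have hlt (i r : Fin n) (h : i < r) : (y ^ 2 - x ^ 2) * K i r = -(x ^ 2 * y ^ 2 * D r) := by
    have := RE i i r r
    rw [hU r i i r h, hV r i i r h, if_neg h.ne', if_neg h.ne, if_pos rfl] at this
    linear_combination this
  have hgt (r a : Fin n) (h : r < a) :
      (y ^ 2 - x ^ 2) * K a r = x * y * (x + y) * Y r a - x ^ 2 * y ^ 2 * D r := by
    have := RE a a r r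
    rw [if_neg h.ne, if_neg h.ne', if_pos rfl] at this
    linear_combination this
  have hdiag (r : Fin n) : (x + y) * K r r = x * y * D r := by
    have := RE r r r r
    simp only [if_true] at this
    -- For equal indices `K r r` occurs on both sides, and the equation has the common factor `y - x
    -- - xy`.
    refine mul_left_cancel₀ vInv_sub_uInv_sub_ne_zero ?_
    linear_combination this
  have hoff (r a : Fin n) (h : r < a) : (x + y) * Y r a = x * y * (D r + D a) := by
    have h1 := RE r a a r
    have h2 := RE a r r a
    rw [hV a r r a h, if_pos rfl, if_pos rfl, if_neg h.ne] at h1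
    rw [hU a r r a h, if_pos rfl, if_pos rfl, if_neg h.ne'] at h2
    -- In each of the two equations one product ends in a raising generator and vanishes. Their sum
    -- closes up in `Y`, `K` and `D`, and `hgt`, `hlt` then eliminate `K`.
    have hX : (y ^ 2 - x ^ 2) * Y r a =
        x * y * (x + y) * (K a r + K r a) + x * y * (y - x) * (D r + D a) := by
      linear_combination h1 + h2
    refine mul_left_cancel₀ nsq (mul_left_cancel₀ nadd ?_)
    linear_combination (y ^ 2 - x ^ 2) * hX + x * y * (x + y) * (hgt r a h + hlt r a h)
  have hDsum (r : Fin n) : D r = ∑ a, Y r a := by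
    simp only [hD, hS, hS', hY, Finset.sum_sub_distrib]
  -- Descending induction on `r`. Once `D a = 0` for `a > r`, summing `Y r a` over `a` gives `(x +
  -- y) D r = m x y D r`, with `m` the number of indices `a ≥ r`.
  have hD0 (r : Fin n) : D r = 0 := by
    induction r using WellFoundedGT.induction with
    | _ r ih =>
    have hterm (a : Fin n) : (x + y) * Y r a =
        (if r = a then 1 else if r < a then 1 else 0) * (x * y) * D r := by
      rcases lt_trichotomy r a with h | h | h
      · rw [hoff r a h, ih a h, if_neg h.ne, if_pos h]
        ring
      · subst h
        rw [if_pos rfl, one_mul]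
        exact hdiag r
      · rw [if_neg h.ne', if_neg h.not_gt]
        simp only [hY]
        rw [hU _ _ _ _ h, hV _ _ _ _ h]
        ring
    have hsum := congrArg ((x + y) * ·) (hDsum r)
    simp only [Finset.mul_sum, hterm] at hsum
    rw [← Finset.sum_mul, ← Finset.sum_mul] at hsum
    refine (mul_eq_zero.1 ?_).resolve_left (nm (∑ a, if r = a then 1 else if r < a then 1 else 0))
    linear_combination hsum
  refine ⟨hD0, fun i r => ?_⟩
  change K i r = 0
  have n2 : y ^ 2 - x ^ 2 ≠ 0 := by
    rw [sq_sub_sq, add_comm y]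
    exact mul_ne_zero nadd nsub
  rcases lt_trichotomy i r with h | rfl | h
  · refine (mul_eq_zero.1 ((hlt i r h).trans ?_)).resolve_left n2
    rw [hD0]; ring
  · refine (mul_eq_zero.1 ((hdiag i).trans ?_)).resolve_left nadd
    rw [hD0]; ring
  · have hY0 : Y r i = 0 := by
      refine (mul_eq_zero.1 ((hoff r i h).trans ?_)).resolve_left nadd
      rw [hD0, hD0]; ring
    refine (mul_eq_zero.1 ((hgt r i h).trans ?_)).resolve_left n2
    rw [hD0, hY0]; ring

/-- The diagonal generators commute on the vectors annihilated by all `b_ij(u)` with `i < j`. -/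
theorem diagonal_smul_comm (hξ : ∀ i j : Fin n, i < j → ∀ p : ℕ, b n l i j p • ξ = 0)
    (i r : Fin n) (p q : ℕ) :
    b n l i i p • b n l r r q • ξ = b n l r r q • b n l i i p • ξ := by
  rw [← sub_eq_zero, ← Module.forall_dual_apply_eq_zero_iff ℂ]
  intro φ
  have h := congrArg (bicoeff p q) ((sum_matrixUV_sub_matrixVU hξ φ).2 i r)
  rw [bicoeff_sub, matrixUV, matrixVU, bicoeff_matrixElement, bicoeff_matrixElement,
    bicoeff_inU_mul_inV, bicoeff_inV_mul_inU, bicoeff_zero, mul_smul, mul_smul] at h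
  rw [map_sub, h]

end Commute

/-! ### Existence of a highest vector. -/

section Existence

variable {n l : ℕ} {V : Type*} [AddCommGroup V] [Module ℂ V] [Module (ReflectionAlgebra n l) V]
  [IsScalarTower ℂ (ReflectionAlgebra n l) V] [FiniteDimensional ℂ V]

theorem exists_eigenspace_annihilated [Nontrivial V] : ∃ a,
    (gradingEnd n l V).eigenspace a ≠ ⊥ ∧ ∀ ξ ∈ (gradingEnd n l V).eigenspace a,
      ∀ i j : Fin n, i < j → ∀ p : ℕ, b n l i j p • ξ = 0 := by
  -- Raising by `j - i > 0` increases the real part, so a nonzero image would contradict maximality.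
  obtain ⟨a, ha, hmax⟩ := Set.exists_max_image {a | (gradingEnd n l V).HasEigenvalue a} Complex.re
    (Module.End.finite_hasEigenvalue _) (Module.End.exists_eigenvalue _)
  refine ⟨a, ha, fun ξ hξ i j hij p => ?_⟩
  by_contra hne
  have hev := Module.End.hasEigenvalue_of_hasEigenvector ⟨b_smul_mem_eigenspace hξ i j p, hne⟩
  have hle := hmax _ hev
  have hij' : ((i : ℕ) : ℝ) < (j : ℕ) := by exact_mod_cast hij
  simp only [Complex.add_re, Complex.sub_re, Complex.natCast_re] at hle
  linarith

theorem isHighestWeight [IsSimpleModule (ReflectionAlgebra n l) V] : IsHighestWeight n l V := by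
  have : Nontrivial V := IsSimpleModule.nontrivial (ReflectionAlgebra n l) V
  obtain ⟨a, ha, hup⟩ := exists_eigenspace_annihilated (n := n) (l := l) (V := V)
  obtain ⟨ξ, hξ, hξ0, hc⟩ := exists_common_eigenvector
    (fun k : Fin n × ℕ => (Algebra.lsmul ℂ ℂ V (b n l k.1 k.1 k.2) : Module.End ℂ V)) _ ha
    (fun k x hx => by simpa using b_smul_mem_eigenspace hx k.1 k.1 k.2)
    (fun k k' x hx => diagonal_smul_comm (hup x hx) _ _ _ _)
  choose c hc using hc
  have hdiag (i : Fin n) (p : ℕ) : b n l i i p • ξ = c (i, p) • ξ := hc (i, p)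
  refine ⟨ξ, fun i => PowerSeries.mk fun p => c (i, p), hξ0,
    IsSimpleModule.span_singleton_eq_top _ hξ0, fun i => ?_, hup ξ hξ, fun i p => ?_⟩
  -- The constant term of the weight is forced, because `b_ii^(0)` is the scalar `ε_i`.
  · have h := hdiag i 0
    rw [b_zero, if_pos rfl, algebraMap_smul] at h
    simpa using (smul_left_injective ℂ hξ0 h).symm
  · rw [coeff_mk, hdiag]

end Existence

end ReflectionAlgebra

end

theorem theorem4p1 (n l : ℕ) (hl : l ≤ n)
    (V : Type*) [AddCommGroup V] [Module ℂ V] [Module (ReflectionAlgebra n l) V]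
    [IsScalarTower ℂ (ReflectionAlgebra n l) V] [FiniteDimensional ℂ V]
    [IsSimpleModule (ReflectionAlgebra n l) V] :
    ReflectionAlgebra.IsHighestWeight n l V ∧
      ∀ ξ η : V, ReflectionAlgebra.IsHighestVector n l ξ →
        ReflectionAlgebra.IsHighestVector n l η → ∃ c : ℂ, c ≠ 0 ∧ η = c • ξ :=
  ⟨ReflectionAlgebra.isHighestWeight, fun _ _ => ReflectionAlgebra.IsHighestVector.unique⟩
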